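/- All multigraphs are finite, may have parallel edges, and have no loops. For a multigraph $G$, let $\Delta(G)$ be its maximum degree. For an integer $k\ge 1$, a $k$-frugal edge colouring of $G$ is a (possibly improper) colouring of the edges of $G$ such that at every vertex each colour appears on at most $k$ of the edges incident with that vertex. The $k$-frugal chromatic index $\chi'_k(G)$ is the least number of colours in a $k$-frugal edge colouring of $G$. The $k$-frugal edge choice number $\mathit{ch}'_k(G)$ is the least $t$ such that, whenever every edge of $G$ is given a list of $t$ integers, there is a $k$-frugal edge colouring of $G$ in which the colour of each edge belongs to its list. Theorem. Let $k\ge 1$ be an odd integer. Then for every multigraph $G$, $$\Bigl\lceil\frac{\Delta(G)}{k}\Bigr\rceil\le\chi'_k(G)\le\mathit{ch}'_k(G)\le\Bigl\lceil\frac{3\,\Delta(G)}{3k-1}\Bigr\rceil.$$ Moreover, the upper bound is tight: for every $m\ge 1$, let $T^{(m)}$ be the multigraph with three vertices and $m$ parallel edges between each pair of them. Then $\Delta(T^{(m)})=2m$ and $$\chi'_k(T^{(m)})=\mathit{ch}'_k(T^{(m)})=\Bigl\lceil\frac{3\,\Delta(T^{(m)})}{3k-1}\Bigr\rceil.$$ 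-/

import Mathlib

namespace FrugalEdge

open scoped Graph

/-- The degree of a vertex: the number of edges incident with it. (Only used for finite multigraphs
without loops, so that no edge has to be counted twice.) -/
noncomputable def degree {α β : Type*} (G : Graph α β) (v : α) : ℕ :=
  {e : β | G.Inc e v}.ncard

/-- The maximum degree `Δ(G)` of a multigraph with finitely many vertices
(`0` if there are no vertices). -/
noncomputable def maxDegree {α β : Type*} (G : Graph α β) : ℕ :=
  sSup (degree G '' V(G))

/-- A colouring of the edges of `G` is `k`-frugal if at every vertex, every colour appears on at most
`k` of the edges incident with that vertex. -/
def IsFrugal {α β C : Type*} (G : Graph α β) (k : ℕ) (c : E(G) → C) : Prop :=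
  ∀ v ∈ V(G), ∀ a : C, {e : E(G) | G.Inc (e : β) v ∧ c e = a}.encard ≤ k

/-- `G` has a `k`-frugal edge colouring with `t` colours. -/
def EdgeColorable {α β : Type*} (G : Graph α β) (k t : ℕ) : Prop :=
  ∃ c : E(G) → Fin t, IsFrugal G k c

/-- For all lists of `t` integers on the edges of `G`, there is a `k`-frugal edge colouring that
gives every edge a colour from its own list. -/
def EdgeChoosable {α β : Type*} (G : Graph α β) (k t : ℕ) : Prop :=
  ∀ L : E(G) → Finset ℤ, (∀ e, (L e).card = t) →
    ∃ c : E(G) → ℤ, (∀ e, c e ∈ L e) ∧ IsFrugal G k c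

/-- The `k`-frugal chromatic index `χ'ₖ(G)`: the least `t` such that `G` has a `k`-frugal edge
colouring with `t` colours (`⊤` if there is no such `t`). -/
noncomputable def chromaticIndex {α β : Type*} (G : Graph α β) (k : ℕ) : ℕ∞ :=
  ⨅ (t : ℕ) (_ : EdgeColorable G k t), (t : ℕ∞)

/-- The `k`-frugal edge choice number `ch'ₖ(G)`: the least `t` such that `G` has `k`-frugal list edge
colourings for all lists of size `t` (`⊤` if there is no such `t`). -/
noncomputable def choiceIndex {α β : Type*} (G : Graph α β) (k : ℕ) : ℕ∞ :=
  ⨅ (t : ℕ) (_ : EdgeChoosable G k t), (t : ℕ∞)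

/-- The triangle multigraph `T^(m)`: three vertices `0, 1, 2` and `m` parallel edges between each
pair; the edges `(i, j)` with `j < m` join `i` and `i + 1` (modulo `3`). -/
def triangle (m : ℕ) : Graph (Fin 3) (Fin 3 × Fin m) where
  vertexSet := Set.univ
  edgeSet := Set.univ
  IsLink e x y := s(x, y) = s(e.1, e.1 + 1)
  isLink_symm _ _ := ⟨fun _ _ h => Sym2.eq_swap.trans h⟩
  eq_or_eq_of_isLink_of_isLink e x y v w h h' := by
    have h2 := h.trans h'.symm
    rw [Sym2.eq_iff] at h2
    exact h2.imp And.left And.left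
  edge_mem_iff_exists_isLink e := ⟨fun _ => ⟨_, _, rfl⟩, fun _ => Set.mem_univ _⟩
  left_mem_of_isLink _ _ _ _ := Set.mem_univ _

end FrugalEdge

/-! Write `k = 2j + 1`. A list size `t` is at least `3Δ/(3k-1)` exactly when `Δ ≤ 2jt + 2t/3`. With
`D = ⌊2t/3⌋`, the edges are split into a part `T` of maximum degree at most `2jt` and a rest of
degree about `D`. `T` receives a `2j`-frugal list colouring and the rest a proper one. Independent
choices suffice, since the multiplicities at a vertex add up to at most `2j + 1`.

For `T` (`exists_even_frugal_list_coloring`), a balanced orientation turns the multigraph into a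
bipartite one with sides "tail" and "head" and maximum degree `jt`. Its edges are properly coloured
with `jt` auxiliary colours. Cutting these into `j` blocks of size `t` splits each bipartite vertex
into `j` copies of degree at most `t`, and Galvin's theorem applies to the copies.

For the rest (`exists_proper_list_coloring`), lists of size `d(u) + d(v)/2` at each end suffice. The
edges inside the two sides of a locally maximal cut are coloured greedily, and the crossing edges by
the local form of Galvin's theorem. Choosing `T` maximal absorbs the rounding when `D` is odd.

The local Galvin theorem combines stable matchings with preference orders built by peeling off
matchings at vertices of maximum degree.

Tightness is a parity count: in `T^(m)` a colour class has at most `⌊3k/2⌋ = (3k-1)/2` edges. -/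

namespace FrugalEdge

/-! ### Bipartite list edge colouring: stable matchings and preference orders -/

section Bipartite

variable {E A B : Type*} [DecidableEq E] [DecidableEq A] [DecidableEq B]

/-- A stable matching with respect to the preferences `p` (on the side of `a`) and `q` (on the side
of `b`), smaller values being preferred. -/
theorem exists_stable_matching (a : E → A) (b : E → B) (p q : E → ℕ) (S : Finset E)
    (hp : ∀ e ∈ S, ∀ f ∈ S, a e = a f → p e = p f → e = f)
    (hq : ∀ e ∈ S, ∀ f ∈ S, b e = b f → q e = q f → e = f) :
    ∃ M ⊆ S, (∀ e ∈ M, ∀ f ∈ M, (a e = a f ∨ b e = b f) → e = f) ∧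
      ∀ e ∈ S, e ∉ M → ∃ f ∈ M, (a f = a e ∧ p f < p e) ∨ (b f = b e ∧ q f < q e) := by
  induction S using Finset.strongInduction with
  | H S ih =>
  -- Deferred acceptance: `T` holds the first choices of the `a`-side. If they do not collide on the
  -- `b`-side, they form the stable matching; otherwise a rejected proposal `f` is deleted.
  set T := S.filter (fun e => ∀ f ∈ S, a f = a e → p e ≤ p f) with hT
  by_cases h : ∀ e ∈ T, ∀ f ∈ T, b e = b f → e = f
  · refine ⟨T, Finset.filter_subset _ _, ?_, ?_⟩
    · rintro e he f hf (hab | hab)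
      · have he' := (Finset.mem_filter.1 he)
        have hf' := (Finset.mem_filter.1 hf)
        exact hp e he'.1 f hf'.1 hab
          (le_antisymm (he'.2 f hf'.1 hab.symm) (hf'.2 e he'.1 hab))
      · exact h e he f hf hab
    · intro e he heT
      have : ∃ g ∈ S, a g = a e ∧ p g < p e := by
        by_contra! hcon
        exact heT (Finset.mem_filter.2 ⟨he, fun f hf hfe => hcon f hf hfe⟩)
      obtain ⟨g, hg, hga, hgp⟩ := this
      obtain ⟨f, hf, hmin⟩ := Finset.exists_min_image (S.filter (fun f => a f = a e)) p
        ⟨g, Finset.mem_filter.2 ⟨hg, hga⟩⟩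
      have hf' := Finset.mem_filter.1 hf
      refine ⟨f, Finset.mem_filter.2 ⟨hf'.1, fun x hx hxf => hmin x
        (Finset.mem_filter.2 ⟨hx, hxf.trans hf'.2⟩)⟩, Or.inl ⟨hf'.2, ?_⟩⟩
      exact (hmin g (Finset.mem_filter.2 ⟨hg, hga⟩)).trans_lt hgp
  · have : ∃ e ∈ T, ∃ f ∈ T, b e = b f ∧ q e < q f := by
      push Not at h
      obtain ⟨e, he, f, hf, hb, hne⟩ := h
      have hne' : q e ≠ q f := fun hh =>
        hne (hq e (Finset.mem_filter.1 he).1 f (Finset.mem_filter.1 hf).1 hb hh)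
      rcases lt_or_gt_of_ne hne' with h1 | h1
      · exact ⟨e, he, f, hf, hb, h1⟩
      · exact ⟨f, hf, e, he, hb.symm, h1⟩
    obtain ⟨e, he, f, hf, hb, hlt⟩ := this
    have he' := Finset.mem_filter.1 he
    have hf' := Finset.mem_filter.1 hf
    obtain ⟨M, hMS, hM, hdom⟩ := ih (S.erase f) (Finset.erase_ssubset hf'.1)
      (fun x hx y hy => hp x (Finset.mem_of_mem_erase hx) y (Finset.mem_of_mem_erase hy))
      (fun x hx y hy => hq x (Finset.mem_of_mem_erase hx) y (Finset.mem_of_mem_erase hy))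
    refine ⟨M, hMS.trans (Finset.erase_subset _ _), hM, ?_⟩
    intro x hx hxM
    by_cases hxf : x = f
    · subst hxf
      have hne : e ≠ x := fun h => by simp [h] at hlt
      by_cases heM : e ∈ M
      · exact ⟨e, heM, Or.inr ⟨hb, hlt⟩⟩
      -- As a first choice, `e` can only be dominated at its `b`-end, which it shares with the
      -- deleted edge; so its dominator also dominates that edge.
      · obtain ⟨g, hg, h1 | h1⟩ := hdom e (Finset.mem_erase.2 ⟨hne, he'.1⟩) heM
        · exact absurd h1.2
            (not_lt.2 (he'.2 g (Finset.mem_of_mem_erase (hMS hg)) h1.1))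
        · exact ⟨g, hg, Or.inr ⟨h1.1.trans hb, h1.2.trans hlt⟩⟩
    · exact hdom x (Finset.mem_erase.2 ⟨hxf, hx⟩) hxM

/-- List colouring from preferences: every list is longer than the number of preferred
neighbouring edges. -/
theorem exists_list_coloring_of_preferences {C : Type*} [DecidableEq C] [Inhabited C] (a : E → A) (b : E → B)
    (p q : E → ℕ) (S : Finset E) (L : E → Finset C)
    (hp : ∀ e ∈ S, ∀ f ∈ S, a e = a f → p e = p f → e = f)
    (hq : ∀ e ∈ S, ∀ f ∈ S, b e = b f → q e = q f → e = f)
    (hL : ∀ e ∈ S, (S.filter (fun f => a f = a e ∧ p f < p e)).card +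
      (S.filter (fun f => b f = b e ∧ q f < q e)).card < (L e).card) :
    ∃ c : E → C, (∀ e ∈ S, c e ∈ L e) ∧
      ∀ e ∈ S, ∀ f ∈ S, (a e = a f ∨ b e = b f) → c e = c f → e = f := by
  induction S using Finset.strongInduction generalizing L with
  | H S ih =>
  rcases S.eq_empty_or_nonempty with rfl | ⟨e₀, he₀⟩
  · exact ⟨fun _ => default, by simp, by simp⟩
  obtain ⟨γ, hγ⟩ : (L e₀).Nonempty := Finset.card_pos.1 (by have := hL e₀ he₀; omega)
  -- `M` becomes the colour class of `γ`. An uncoloured edge that loses `γ` from its list also loses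
  -- a preferred neighbour, so the strict inequality survives.
  obtain ⟨M, hMS, hM, hdom⟩ := exists_stable_matching a b p q (S.filter (fun e => γ ∈ L e))
    (fun x hx y hy => hp x (Finset.mem_filter.1 hx).1 y (Finset.mem_filter.1 hy).1)
    (fun x hx y hy => hq x (Finset.mem_filter.1 hx).1 y (Finset.mem_filter.1 hy).1)
  have hMne : M.Nonempty := by
    by_contra hne
    rw [Finset.not_nonempty_iff_eq_empty] at hne
    subst hne
    obtain ⟨f, hf, -⟩ := hdom e₀ (Finset.mem_filter.2 ⟨he₀, hγ⟩) (by simp)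
    simp at hf
  have hMS' : M ⊆ S := hMS.trans (Finset.filter_subset _ _)
  obtain ⟨c, hcL, hc⟩ := ih (S \ M) (Finset.sdiff_ssubset hMS' hMne) (fun e => (L e).erase γ)
    (fun x hx y hy => hp x (Finset.mem_sdiff.1 hx).1 y (Finset.mem_sdiff.1 hy).1)
    (fun x hx y hy => hq x (Finset.mem_sdiff.1 hx).1 y (Finset.mem_sdiff.1 hy).1) (by
      intro e he
      obtain ⟨heS, heM⟩ := Finset.mem_sdiff.1 he
      have h0 := hL e heS
      have h1 : ((S \ M).filter (fun f => a f = a e ∧ p f < p e)) ⊆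
        (S.filter (fun f => a f = a e ∧ p f < p e)) :=
        Finset.filter_subset_filter _ Finset.sdiff_subset
      have h2 : ((S \ M).filter (fun f => b f = b e ∧ q f < q e)) ⊆
        (S.filter (fun f => b f = b e ∧ q f < q e)) :=
        Finset.filter_subset_filter _ Finset.sdiff_subset
      by_cases hγe : γ ∈ L e
      · rw [Finset.card_erase_of_mem hγe]
        obtain ⟨f, hf, h3 | h3⟩ := hdom e (Finset.mem_filter.2 ⟨heS, hγe⟩) heM
        · have h4 := Finset.card_lt_card (h1.ssubset_of_mem_notMem (a := f)
            (Finset.mem_filter.2 ⟨hMS' hf, h3⟩) (by simp [hf]))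
          have h5 := Finset.card_le_card h2
          omega
        · have h4 := Finset.card_lt_card (h2.ssubset_of_mem_notMem (a := f)
            (Finset.mem_filter.2 ⟨hMS' hf, h3⟩) (by simp [hf]))
          have h5 := Finset.card_le_card h1
          omega
      · rw [Finset.erase_eq_of_notMem hγe]
        have h4 := Finset.card_le_card h1
        have h5 := Finset.card_le_card h2
        omega)
  refine ⟨fun e => if e ∈ M then γ else c e, ?_, ?_⟩
  · intro e he
    by_cases heM : e ∈ M
    · simpa [heM] using (Finset.mem_filter.1 (hMS heM)).2
    · simpa [heM] using Finset.mem_of_mem_erase (hcL e (Finset.mem_sdiff.2 ⟨he, heM⟩))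
  · intro e he f hf hadj hcol
    by_cases heM : e ∈ M <;> by_cases hfM : f ∈ M <;> simp only [heM, hfM, if_true, if_false] at hcol
    · exact hM e heM f hfM hadj
    · exact absurd hcol.symm (Finset.ne_of_mem_erase (hcL f (Finset.mem_sdiff.2 ⟨hf, hfM⟩)))
    · exact absurd hcol (Finset.ne_of_mem_erase (hcL e (Finset.mem_sdiff.2 ⟨he, heM⟩)))
    · exact hc e (Finset.mem_sdiff.2 ⟨he, heM⟩) f (Finset.mem_sdiff.2 ⟨hf, hfM⟩) hadj hcol

/-- If some nonempty `s` has at most `#s` neighbours in `U`, then there is a nonempty matching whose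
`b`-ends lie in `s` and that covers all neighbours in `U` of its `b`-ends. -/
theorem exists_matching_covering_neighbors (a : E → A) (b : E → B) (S : Finset E) (U : Finset A)
    (s : Finset B) (hs : s.Nonempty) (hinc : ∀ w ∈ s, ∃ e ∈ S, b e = w)
    (hN : (U.filter (fun u => ∃ e ∈ S, a e = u ∧ b e ∈ s)).card ≤ s.card) :
    ∃ M ⊆ S, M.Nonempty ∧ (∀ e ∈ M, ∀ f ∈ M, (a e = a f ∨ b e = b f) → e = f) ∧
      (∀ e ∈ M, b e ∈ s) ∧
      ∀ e ∈ S, (∃ f ∈ M, b f = b e) → a e ∈ U → ∃ f ∈ M, a f = a e := by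
  induction s using Finset.strongInduction with
  | H s ih =>
  -- Reduces to a minimal `s`: then every proper nonempty subset has strictly more neighbours in `U`
  -- than elements, which yields Hall's condition.
  by_cases hred : ∃ s' ⊂ s, s'.Nonempty ∧
      (U.filter (fun u => ∃ e ∈ S, a e = u ∧ b e ∈ s')).card ≤ s'.card
  · obtain ⟨s', hs', hne, hN'⟩ := hred
    obtain ⟨M, h1, h2, h3, h4, h5⟩ := ih s' hs' hne (fun w hw => hinc w (hs'.1 hw)) hN'
    exact ⟨M, h1, h2, h3, fun e he => hs'.1 (h4 e he), h5⟩
  push Not at hred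
  have hmono : ∀ s' ⊆ s, U.filter (fun u => ∃ e ∈ S, a e = u ∧ b e ∈ s') ⊆
      U.filter (fun u => ∃ e ∈ S, a e = u ∧ b e ∈ s) := by
    intro s' hs' u hu
    simp only [Finset.mem_filter] at hu ⊢
    obtain ⟨hu, e, he, h1, h2⟩ := hu
    exact ⟨hu, e, he, h1, hs' h2⟩
  rcases (U.filter (fun u => ∃ e ∈ S, a e = u ∧ b e ∈ s)).eq_empty_or_nonempty with hemp | hUne
  · obtain ⟨w, hw⟩ := hs
    obtain ⟨e, he, rfl⟩ := hinc w hw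
    refine ⟨{e}, by simpa using he, by simp, by simp, by simpa using hw, ?_⟩
    intro f hf hfe hfU
    have : a f ∈ U.filter (fun u => ∃ e ∈ S, a e = u ∧ b e ∈ s) := by
      simp only [Finset.mem_singleton, exists_eq_left] at hfe
      exact Finset.mem_filter.2 ⟨hfU, f, hf, rfl, hfe ▸ hw⟩
    rw [hemp] at this
    simp at this
  have hHall : ∀ s' ⊆ s, s'.card ≤ (U.filter (fun u => ∃ e ∈ S, a e = u ∧ b e ∈ s')).card := by
    intro s' hs'
    rcases s'.eq_empty_or_nonempty with rfl | hne
    · simp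
    rcases hs'.eq_or_ssubset with rfl | hss
    -- Hall's condition for `s` itself follows from minimality after removing one vertex. If nothing
    -- remains, `#s = 1` and the nonempty neighbourhood suffices.
    · by_contra! hlt
      obtain ⟨w, hw⟩ := hs
      have hpos := hUne.card_pos
      have hc := Finset.card_erase_of_mem hw
      have h1 := hred (s'.erase w) (Finset.erase_ssubset hw) (Finset.card_pos.1 (by omega))
      have h2 := Finset.card_le_card (hmono (s'.erase w) (Finset.erase_subset _ _))
      omega
    · exact (hred s' hss hne).le
  obtain ⟨f, hfinj, hf⟩ := (Finset.all_card_le_biUnion_card_iff_exists_injective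
    (fun w : s => U.filter (fun u => ∃ e ∈ S, a e = u ∧ b e = w))).1 (by
      intro s'
      have h := hHall (s'.map (Function.Embedding.subtype _)) (by
        intro x hx
        simp only [Finset.mem_map] at hx
        obtain ⟨y, -, rfl⟩ := hx
        exact y.2)
      rw [Finset.card_map] at h
      refine h.trans (Finset.card_le_card ?_)
      intro u hu
      simp only [Finset.mem_filter, Finset.mem_map, Finset.mem_biUnion] at hu ⊢
      obtain ⟨hu, e, he, h1, w, hw, h2⟩ := hu
      exact ⟨w, hw, hu, e, he, h1, h2.symm⟩)
  have hf' : ∀ w : s, ∃ e ∈ S, a e = f w ∧ b e = w := fun w => (Finset.mem_filter.1 (hf w)).2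
  choose g hgS hga hgb using hf'
  -- The neighbourhood has at most `#s` elements, so the Hall matching saturates it too.
  have himg : Finset.univ.image f = U.filter (fun u => ∃ e ∈ S, a e = u ∧ b e ∈ s) := by
    apply Finset.eq_of_subset_of_card_le
    · intro u hu
      obtain ⟨w, -, rfl⟩ := Finset.mem_image.1 hu
      exact Finset.mem_filter.2 ⟨(Finset.mem_filter.1 (hf w)).1, g w, hgS w, hga w,
        by rw [hgb]; exact w.2⟩
    · rw [Finset.card_image_of_injective _ hfinj]
      simpa using hN
  refine ⟨Finset.univ.image g, ?_, ?_, ?_, ?_, ?_⟩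
  · intro e he
    obtain ⟨w, -, rfl⟩ := Finset.mem_image.1 he
    exact hgS w
  · obtain ⟨w, hw⟩ := hs
    exact ⟨g ⟨w, hw⟩, by simp⟩
  · intro e he e' he' h
    obtain ⟨w, -, rfl⟩ := Finset.mem_image.1 he
    obtain ⟨w', -, rfl⟩ := Finset.mem_image.1 he'
    rw [hga, hga, hgb, hgb] at h
    rcases h with h | h
    · rw [hfinj h]
    · rw [Subtype.ext h]
  · intro e he
    obtain ⟨w, -, rfl⟩ := Finset.mem_image.1 he
    rw [hgb]; exact w.2
  · rintro e he ⟨x, hx, hxb⟩ heU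
    obtain ⟨w, -, rfl⟩ := Finset.mem_image.1 hx
    have : a e ∈ Finset.univ.image f := by
      rw [himg]
      exact Finset.mem_filter.2 ⟨heU, e, he, rfl, by rw [← hxb, hgb]; exact w.2⟩
    obtain ⟨w', -, hw'⟩ := Finset.mem_image.1 this
    exact ⟨g w', by simp, by rw [hga, hw']⟩

/-- Preference orders at the vertices such that every edge has fewer preferred neighbours than the
larger of the degrees of its ends. -/
def HasGoodPreferences (a : E → A) (b : E → B) (S : Finset E) : Prop :=
  ∃ p q : E → ℕ, (∀ e ∈ S, ∀ f ∈ S, a e = a f → p e = p f → e = f) ∧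
    (∀ e ∈ S, ∀ f ∈ S, b e = b f → q e = q f → e = f) ∧
    ∀ e ∈ S, (S.filter (fun f => a f = a e ∧ p f < p e)).card +
      (S.filter (fun f => b f = b e ∧ q f < q e)).card <
      max (S.filter (fun f => a f = a e)).card (S.filter (fun f => b f = b e)).card

omit [DecidableEq E] in
theorem HasGoodPreferences.symm {a : E → A} {b : E → B} {S : Finset E}
    (h : HasGoodPreferences a b S) : HasGoodPreferences b a S := by
  obtain ⟨p, q, hp, hq, h⟩ := h
  exact ⟨q, p, hq, hp, fun e he => by rw [add_comm, max_comm]; exact h e he⟩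

/-- Edges of `M` are made least preferred at their `a`-ends and most preferred at their `b`-ends. An
edge outside `M` gains a preferred neighbour only if `M` meets its `b`-end. That end has degree `d`,
and by `hcov` both ends have degree below `d` after `M` is removed, so the bound rises to `d` and
pays for the gain. -/
theorem HasGoodPreferences.of_sdiff {a : E → A} {b : E → B} {S M : Finset E} (hMS : M ⊆ S)
    (hM : ∀ e ∈ M, ∀ f ∈ M, (a e = a f ∨ b e = b f) → e = f) (d : ℕ)
    (ha : ∀ e ∈ S, (S.filter (fun f => a f = a e)).card ≤ d)
    (hb : ∀ e ∈ M, (S.filter (fun f => b f = b e)).card = d)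
    (hcov : ∀ e ∈ S, (∃ f ∈ M, b f = b e) → (S.filter (fun f => a f = a e)).card = d →
      ∃ f ∈ M, a f = a e)
    (h : HasGoodPreferences a b (S \ M)) : HasGoodPreferences a b S := by
  obtain ⟨p, q, hp, hq, h⟩ := h
  obtain ⟨K, hK⟩ : ∃ K, ∀ e ∈ S, p e < K :=
    ⟨S.sup p + 1, fun e he => Nat.lt_succ_of_le (Finset.le_sup he)⟩
  refine ⟨fun e => if e ∈ M then K else p e, fun e => if e ∈ M then 0 else q e + 1, ?_, ?_, ?_⟩
  · intro e he f hf hef hpe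
    by_cases heM : e ∈ M <;> by_cases hfM : f ∈ M <;> simp only [heM, hfM, if_true, if_false] at hpe
    · exact hM e heM f hfM (Or.inl hef)
    · exact absurd hpe (hK f hf).ne'
    · exact absurd hpe (hK e he).ne
    · exact hp e (by simp [he, heM]) f (by simp [hf, hfM]) hef hpe
  · intro e he f hf hef hqe
    by_cases heM : e ∈ M <;> by_cases hfM : f ∈ M <;> simp only [heM, hfM, if_true, if_false] at hqe
    · exact hM e heM f hfM (Or.inr hef)
    · omega
    · omega
    · exact hq e (by simp [he, heM]) f (by simp [hf, hfM]) hef (by omega)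
  · intro e he
    by_cases heM : e ∈ M
    · simp only [heM, if_true, not_lt_zero, and_false, Finset.filter_false, Finset.card_empty,
        add_zero]
      refine lt_of_lt_of_le (Finset.card_lt_card (Finset.ssubset_iff_subset_ne.2 ⟨?_, ?_⟩))
        (le_max_left _ _)
      · exact Finset.monotone_filter_right _ (fun _ _ h => h.1)
      · intro heq
        have : e ∈ S.filter (fun f => a f = a e) := by simp [he]
        rw [← heq] at this
        simp [heM] at this
    · have he' : e ∈ S \ M := by simp [he, heM]
      have h0 := h e he'
      have h1 : S.filter (fun f => a f = a e ∧ (if f ∈ M then K else p f) < p e) =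
          (S \ M).filter (fun f => a f = a e ∧ p f < p e) := by
        ext f
        simp only [Finset.mem_filter, Finset.mem_sdiff]
        have := hK e he
        by_cases hfM : f ∈ M
        · simp only [hfM, if_true]; constructor
          · rintro ⟨-, -, h⟩; omega
          · simp
        · simp [hfM]
      have ha' : ((S \ M).filter (fun f => a f = a e)).card ≤ (S.filter (fun f => a f = a e)).card :=
        Finset.card_le_card (Finset.filter_subset_filter _ Finset.sdiff_subset)
      have hb' : ((S \ M).filter (fun f => b f = b e)).card ≤ (S.filter (fun f => b f = b e)).card :=
        Finset.card_le_card (Finset.filter_subset_filter _ Finset.sdiff_subset)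
      simp only [heM, if_false, h1]
      by_cases hc : ∃ f ∈ M, b f = b e
      · obtain ⟨x, hxM, hxb⟩ := hc
        have h2 : S.filter (fun f => b f = b e ∧ (if f ∈ M then 0 else q f + 1) < q e + 1) ⊆
            insert x ((S \ M).filter (fun f => b f = b e ∧ q f < q e)) := by
          intro f
          simp only [Finset.mem_filter, Finset.mem_sdiff, Finset.mem_insert]
          rintro ⟨hf, hfb, hlt⟩
          by_cases hfM : f ∈ M
          · exact Or.inl (hM f hfM x hxM (Or.inr (hfb.trans hxb.symm)))
          · simp only [hfM, if_false] at hlt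
            exact Or.inr ⟨⟨hf, hfM⟩, hfb, by omega⟩
        have h3 := (Finset.card_le_card h2).trans (Finset.card_insert_le _ _)
        have h4 : ((S \ M).filter (fun f => b f = b e)).card < (S.filter (fun f => b f = b e)).card :=
          Finset.card_lt_card ((Finset.filter_subset_filter _ Finset.sdiff_subset).ssubset_of_mem_notMem
            (a := x) (by simp [hMS hxM, hxb]) (by simp [hxM]))
        have h5 : (S.filter (fun f => b f = b e)).card = d := by
          rw [← hxb]; exact hb x hxM
        have h6 : ((S \ M).filter (fun f => a f = a e)).card < d := by
          rcases (ha e he).lt_or_eq with h6 | h6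
          · exact ha'.trans_lt h6
          · obtain ⟨y, hyM, hya⟩ := hcov e he ⟨x, hxM, hxb⟩ h6
            rw [← h6]
            exact Finset.card_lt_card
              ((Finset.filter_subset_filter _ Finset.sdiff_subset).ssubset_of_mem_notMem
              (a := y) (by simp [hMS hyM, hya]) (by simp [hyM]))
        have h7 := ha e he
        omega
      · have h2 : S.filter (fun f => b f = b e ∧ (if f ∈ M then 0 else q f + 1) < q e + 1) =
            (S \ M).filter (fun f => b f = b e ∧ q f < q e) := by
          ext f
          simp only [Finset.mem_filter, Finset.mem_sdiff]
          by_cases hfM : f ∈ M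
          · simp only [hfM, not_true_eq_false, and_false, false_and, iff_false]
            rintro ⟨-, h, -⟩
            exact hc ⟨f, hfM, h⟩
          · simp [hfM]
        rw [h2]
        omega

theorem hasGoodPreferences (a : E → A) (b : E → B) (S : Finset E) : HasGoodPreferences a b S := by
  induction S using Finset.strongInduction with
  | H S ih =>
  rcases S.eq_empty_or_nonempty with rfl | ⟨e₀, he₀⟩
  · exact ⟨0, 0, by simp, by simp, by simp⟩
  obtain ⟨x, hx, hmax⟩ := Finset.exists_max_image S
    (fun e => max (S.filter (fun f => a f = a e)).card (S.filter (fun f => b f = b e)).card)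
    ⟨e₀, he₀⟩
  set d := max (S.filter (fun f => a f = a x)).card (S.filter (fun f => b f = b x)).card with hd
  have ha : ∀ e ∈ S, (S.filter (fun f => a f = a e)).card ≤ d :=
    fun e he => (le_max_left _ _).trans (hmax e he)
  have hb : ∀ e ∈ S, (S.filter (fun f => b f = b e)).card ≤ d :=
    fun e he => (le_max_right _ _).trans (hmax e he)
  set U := (S.image a).filter (fun u => (S.filter (fun f => a f = u)).card = d) with hU
  set W := (S.image b).filter (fun w => (S.filter (fun f => b f = w)).card = d) with hW
  have hUW : U.Nonempty ∨ W.Nonempty := by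
    rcases max_choice (S.filter (fun f => a f = a x)).card (S.filter (fun f => b f = b x)).card
      with h | h
    · exact Or.inl ⟨a x, Finset.mem_filter.2 ⟨Finset.mem_image_of_mem _ hx, by rw [hd, h]⟩⟩
    · exact Or.inr ⟨b x, Finset.mem_filter.2 ⟨Finset.mem_image_of_mem _ hx, by rw [hd, h]⟩⟩
  -- The side with at least as many vertices of maximum degree serves as `s` in the matching lemma;
  -- the condition is symmetric in the two sides.
  have hcases : (W.Nonempty ∧ U.card ≤ W.card) ∨ (U.Nonempty ∧ W.card ≤ U.card) := by
    rcases le_total U.card W.card with h | h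
    · refine Or.inl ⟨?_, h⟩
      rcases hUW with h1 | h1
      · exact Finset.card_pos.1 (h1.card_pos.trans_le h)
      · exact h1
    · refine Or.inr ⟨?_, h⟩
      rcases hUW with h1 | h1
      · exact h1
      · exact Finset.card_pos.1 (h1.card_pos.trans_le h)
  rcases hcases with ⟨hne, hle⟩ | ⟨hne, hle⟩
  · obtain ⟨M, hMS, hMne, hM, hMW, hcov⟩ := exists_matching_covering_neighbors a b S U W hne
      (fun w hw => by simpa using (Finset.mem_filter.1 hw).1)
      ((Finset.card_filter_le _ _).trans hle)
    refine HasGoodPreferences.of_sdiff hMS hM d ha (fun e he => (Finset.mem_filter.1 (hMW e he)).2)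
      (fun e he h1 h2 => hcov e he h1
        (Finset.mem_filter.2 ⟨Finset.mem_image_of_mem _ he, h2⟩))
      (ih _ (Finset.sdiff_ssubset hMS hMne))
  · obtain ⟨M, hMS, hMne, hM, hMW, hcov⟩ := exists_matching_covering_neighbors b a S W U hne
      (fun w hw => by simpa using (Finset.mem_filter.1 hw).1)
      ((Finset.card_filter_le _ _).trans hle)
    refine (HasGoodPreferences.of_sdiff hMS hM d hb
      (fun e he => (Finset.mem_filter.1 (hMW e he)).2)
      (fun e he h1 h2 => hcov e he h1
        (Finset.mem_filter.2 ⟨Finset.mem_image_of_mem _ he, h2⟩))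
      (ih _ (Finset.sdiff_ssubset hMS hMne)).symm).symm

/-- Galvin's theorem in the local form of Borodin, Kostochka and Woodall: a bipartite multigraph has
a proper list edge colouring if every list is at least as long as the degrees of both ends. -/
theorem exists_proper_list_coloring_of_bipartite {C : Type*} [DecidableEq C] [Inhabited C] (a : E → A) (b : E → B)
    (S : Finset E) (L : E → Finset C)
    (ha : ∀ e ∈ S, (S.filter (fun f => a f = a e)).card ≤ (L e).card)
    (hb : ∀ e ∈ S, (S.filter (fun f => b f = b e)).card ≤ (L e).card) :
    ∃ c : E → C, (∀ e ∈ S, c e ∈ L e) ∧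
      ∀ e ∈ S, ∀ f ∈ S, (a e = a f ∨ b e = b f) → c e = c f → e = f := by
  obtain ⟨p, q, hp, hq, h⟩ := hasGoodPreferences a b S
  exact exists_list_coloring_of_preferences a b p q S L hp hq
    (fun e he => (h e he).trans_le (max_le (ha e he) (hb e he)))

end Bipartite

/-! ### Orientations, degree splittings and list colourings of multigraphs -/

section Multigraph

variable {E V : Type*} [DecidableEq E] [DecidableEq V]

/-- Every multigraph has an orientation in which in- and outdegrees differ by at most one. -/
theorem exists_balanced_orientation (z : E → Sym2 V) (S : Finset E) :
    ∃ a b : E → V, (∀ e, s(a e, b e) = z e) ∧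
      ∀ v, |∑ e ∈ S, ((if a e = v then 1 else 0) - (if b e = v then 1 else 0) : ℤ)| ≤ 1 := by
  induction S using Finset.strongInduction generalizing z with
  | H S ih =>
  by_cases h : ∃ e ∈ S, ∃ f ∈ S, e ≠ f ∧ ∃ v, v ∈ z e ∧ v ∈ z f
  · obtain ⟨e, he, f, hf, hef, v, ⟨x, hx⟩, ⟨y, hy⟩⟩ := h
    -- Splitting off: the edges `vx` and `vy` are replaced by one edge `xy`, whose orientation is
    -- then rerouted through `v`, leaving every imbalance unchanged. If `x = y` this creates a loop,
    -- which is why loops are allowed here.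
    obtain ⟨a, b, hab, hbal⟩ := ih (S.erase f) (Finset.erase_ssubset hf)
      (Function.update z e s(x, y))
    have he' : e ∈ S.erase f := Finset.mem_erase.2 ⟨hef, he⟩
    have key : ∀ p q r w : V, s(p, q) = z e → s(r, w) = z f →
        (∀ u, ((if p = u then 1 else 0) - (if q = u then 1 else 0) : ℤ) +
          ((if r = u then 1 else 0) - (if w = u then 1 else 0)) =
          (if a e = u then 1 else 0) - (if b e = u then 1 else 0)) →
        ∃ a b : E → V, (∀ e, s(a e, b e) = z e) ∧ ∀ v,
          |∑ e ∈ S, ((if a e = v then 1 else 0) - (if b e = v then 1 else 0) : ℤ)| ≤ 1 := by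
      intro p q r w h1 h2 h3
      refine ⟨Function.update (Function.update a e p) f r,
        Function.update (Function.update b e q) f w, ?_, ?_⟩
      · intro g
        by_cases hgf : g = f
        · subst hgf; simpa using h2
        by_cases hge : g = e
        · subst hge; simpa [hgf] using h1
        · simpa [hgf, hge] using hab g
      · intro u
        convert hbal u using 2
        rw [← Finset.add_sum_erase _ _ hf, ← Finset.add_sum_erase _ _ he',
          ← Finset.add_sum_erase _ _ he', ← h3 u]
        simp only [Function.update_self, Function.update_of_ne hef]
        rw [← add_assoc]
        congr 1
        · ring
        · refine Finset.sum_congr rfl fun g hg => ?_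
          have hge := Finset.ne_of_mem_erase hg
          have hgf := Finset.ne_of_mem_erase (Finset.mem_of_mem_erase hg)
          simp [hge, hgf]
    have hxy : s(a e, b e) = s(x, y) := by simpa using hab e
    rcases Sym2.eq_iff.1 hxy with ⟨h1, h2⟩ | ⟨h1, h2⟩
    · refine key x v v y (by rw [hx, Sym2.eq_swap]) hy.symm fun u => ?_
      rw [h1, h2]; ring
    · refine key v x y v hx.symm (by rw [hy, Sym2.eq_swap]) fun u => ?_
      rw [h1, h2]; ring
  · push Not at h
    have hz : ∀ e, s((z e).out.1, (z e).out.2) = z e := fun e => (z e).out_eq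
    refine ⟨fun e => (z e).out.1, fun e => (z e).out.2, hz, fun v => ?_⟩
    by_cases hv : ∃ e ∈ S, v ∈ z e
    · obtain ⟨e, he, hve⟩ := hv
      rw [Finset.sum_eq_single_of_mem e he]
      · split_ifs <;> simp
      · intro f hf hfe
        have hvf := h e he f hf hfe.symm v hve
        have h1 : (z f).out.1 ≠ v := fun h => hvf (h ▸ Sym2.out_fst_mem _)
        have h2 : (z f).out.2 ≠ v := fun h => hvf (h ▸ Sym2.out_snd_mem _)
        simp [h1, h2]
    · push Not at hv
      rw [Finset.sum_eq_zero]
      · simp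
      · intro f hf
        have hvf := hv f hf
        have h1 : (z f).out.1 ≠ v := fun h => hvf (h ▸ Sym2.out_fst_mem _)
        have h2 : (z f).out.2 ≠ v := fun h => hvf (h ▸ Sym2.out_snd_mem _)
        simp [h1, h2]

theorem exists_orientation_of_degree_le (z : E → Sym2 V) (S : Finset E)
    (hz : ∀ e ∈ S, ¬ (z e).IsDiag) (n : ℕ)
    (hdeg : ∀ v, (S.filter (fun e => v ∈ z e)).card ≤ 2 * n) :
    ∃ a b : E → V, (∀ e, s(a e, b e) = z e) ∧ (∀ v, (S.filter (fun e => a e = v)).card ≤ n) ∧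
      ∀ v, (S.filter (fun e => b e = v)).card ≤ n := by
  obtain ⟨a, b, hab, hbal⟩ := exists_balanced_orientation z S
  have hsum : ∀ v, (S.filter (fun e => v ∈ z e)).card =
      (S.filter (fun e => a e = v)).card + (S.filter (fun e => b e = v)).card := by
    intro v
    rw [← Finset.card_union_of_disjoint, ← Finset.filter_or]
    · congr 1
      ext e
      simp only [Finset.mem_filter, ← hab e, Sym2.mem_iff, eq_comm]
    · rw [Finset.disjoint_filter]
      intro e he h1 h2
      apply hz e he
      rw [← hab e, h1, h2]
      simp
  have hdiff : ∀ v, |((S.filter (fun e => a e = v)).card : ℤ) -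
      (S.filter (fun e => b e = v)).card| ≤ 1 := by
    intro v
    have := hbal v
    rwa [Finset.sum_sub_distrib, Finset.sum_boole, Finset.sum_boole] at this
  refine ⟨a, b, hab, fun v => ?_, fun v => ?_⟩ <;>
  · have h1 := hsum v
    have h2 := hdeg v
    have h3 := abs_le.1 (hdiff v)
    omega

/-- A bipartite multigraph with maximum degree at most `n` has a proper edge colouring with `n`
colours. -/
theorem exists_proper_coloring_of_bipartite {A B : Type*} [DecidableEq A] [DecidableEq B]
    (a : E → A) (b : E → B) (S : Finset E) (n : ℕ)
    (ha : ∀ v, (S.filter (fun e => a e = v)).card ≤ n)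
    (hb : ∀ v, (S.filter (fun e => b e = v)).card ≤ n) :
    ∃ κ : E → ℕ, (∀ e ∈ S, κ e < n) ∧
      ∀ e ∈ S, ∀ f ∈ S, (a e = a f ∨ b e = b f) → κ e = κ f → e = f := by
  obtain ⟨κ, h1, h2⟩ := exists_proper_list_coloring_of_bipartite a b S (fun _ => Finset.range n)
    (fun e _ => by simpa using ha (a e)) (fun e _ => by simpa using hb (b e))
  exact ⟨κ, fun e he => by simpa using h1 e he, h2⟩

-- Within one block of `t` consecutive auxiliary colours, the residue modulo `t` determines the edge
-- at `v`.
omit [DecidableEq E] in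
theorem card_filter_le_of_div_eq {A : Type*} [DecidableEq A] (a : E → A) (S : Finset E) (κ : E → ℕ)
    (t : ℕ) (hκ : ∀ e ∈ S, ∀ f ∈ S, a e = a f → κ e = κ f → e = f) (ht : 0 < t) (v : A) (i : ℕ) :
    (S.filter (fun f => (a f, κ f / t) = (v, i))).card ≤ t := by
  have h : (S.filter (fun f => (a f, κ f / t) = (v, i))).card ≤ (Finset.range t).card := by
    refine Finset.card_le_card_of_injOn (fun f => κ f % t)
      (fun f _ => by simpa using Nat.mod_lt _ ht) ?_
    intro e he f hf hef
    simp only [Finset.coe_filter, Set.mem_ofPred_eq, Prod.mk.injEq] at he hf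
    refine hκ e he.1 f hf.1 (he.2.1.trans hf.2.1.symm) ?_
    rw [← Nat.div_add_mod (κ e) t, ← Nat.div_add_mod (κ f) t, he.2.2, hf.2.2]
    exact congrArg _ hef
  simpa using h

-- Each of the `j` copies of `v` contributes at most one edge of colour `γ`.
omit [DecidableEq E] in
theorem card_filter_color_le {A C : Type*} [DecidableEq A] [DecidableEq C] (a : E → A)
    (S : Finset E) (κ : E → ℕ) (c : E → C) (j t : ℕ) (hκt : ∀ e ∈ S, κ e < j * t)
    (hc : ∀ e ∈ S, ∀ f ∈ S, (a e, κ e / t) = (a f, κ f / t) → c e = c f → e = f) (v : A) (γ : C) :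
    (S.filter (fun f => a f = v ∧ c f = γ)).card ≤ j := by
  have h : (S.filter (fun f => a f = v ∧ c f = γ)).card ≤ (Finset.range j).card := by
    refine Finset.card_le_card_of_injOn (fun f => κ f / t) (fun f hf => ?_) ?_
    · have hf' := (Finset.mem_filter.1 hf).1
      simpa using Nat.div_lt_of_lt_mul (by rw [mul_comm]; exact hκt f hf')
    · intro e he f hf hef
      simp only [Finset.coe_filter, Set.mem_ofPred_eq] at he hf
      exact hc e he.1 f hf.1 (Prod.ext (he.2.1.trans hf.2.1.symm) hef)
        (he.2.2.trans hf.2.2.symm)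
  simpa using h

theorem exists_frugal_list_coloring_of_bipartite {A B C : Type*} [DecidableEq A] [DecidableEq B]
    [DecidableEq C] [Inhabited C] (a : E → A) (b : E → B) (S : Finset E) (j t : ℕ)
    (L : E → Finset C) (hL : ∀ e ∈ S, t ≤ (L e).card)
    (ha : ∀ v, (S.filter (fun e => a e = v)).card ≤ j * t)
    (hb : ∀ v, (S.filter (fun e => b e = v)).card ≤ j * t) :
    ∃ c : E → C, (∀ e ∈ S, c e ∈ L e) ∧
      (∀ v γ, (S.filter (fun e => a e = v ∧ c e = γ)).card ≤ j) ∧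
      ∀ v γ, (S.filter (fun e => b e = v ∧ c e = γ)).card ≤ j := by
  obtain ⟨κ, hκt, hκ⟩ := exists_proper_coloring_of_bipartite a b S (j * t) ha hb
  have ht : ∀ e ∈ S, 0 < t := by
    intro e he
    rcases Nat.eq_zero_or_pos t with rfl | h
    · exact absurd (hκt e he) (by simp)
    · exact h
  -- Vertices are split into copies indexed by the block `κ e / t`, each of degree at most `t`; both
  -- ends of an edge use the same block.
  obtain ⟨c, hcL, hc⟩ := exists_proper_list_coloring_of_bipartite
    (fun e => (a e, κ e / t)) (fun e => (b e, κ e / t)) S L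
    (fun e he => (card_filter_le_of_div_eq a S κ t
      (fun e he f hf h => hκ e he f hf (Or.inl h)) (ht e he) _ _).trans (hL e he))
    (fun e he => (card_filter_le_of_div_eq b S κ t
      (fun e he f hf h => hκ e he f hf (Or.inr h)) (ht e he) _ _).trans (hL e he))
  exact ⟨c, hcL,
    card_filter_color_le a S κ c j t hκt (fun e he f hf h => hc e he f hf (Or.inl h)),
    card_filter_color_le b S κ c j t hκt (fun e he f hf h => hc e he f hf (Or.inr h))⟩

/-- A multigraph with maximum degree at most `2 * j * t` has a `2 * j`-frugal list edge colouring
for lists of size `t`. -/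
theorem exists_even_frugal_list_coloring {C : Type*} [DecidableEq C] [Inhabited C] (z : E → Sym2 V)
    (S : Finset E) (hz : ∀ e ∈ S, ¬ (z e).IsDiag) (j t : ℕ)
    (hdeg : ∀ v, (S.filter (fun e => v ∈ z e)).card ≤ 2 * (j * t))
    (L : E → Finset C) (hL : ∀ e ∈ S, t ≤ (L e).card) :
    ∃ c : E → C, (∀ e ∈ S, c e ∈ L e) ∧
      ∀ v γ, (S.filter (fun e => v ∈ z e ∧ c e = γ)).card ≤ 2 * j := by
  obtain ⟨a, b, hab, ha, hb⟩ := exists_orientation_of_degree_le z S hz (j * t) hdeg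
  obtain ⟨c, hcL, hca, hcb⟩ := exists_frugal_list_coloring_of_bipartite a b S j t L hL ha hb
  refine ⟨c, hcL, fun v γ => ?_⟩
  have h : S.filter (fun e => v ∈ z e ∧ c e = γ) ⊆
      S.filter (fun e => a e = v ∧ c e = γ) ∪ S.filter (fun e => b e = v ∧ c e = γ) := by
    intro e
    simp only [Finset.mem_filter, Finset.mem_union, ← hab e, Sym2.mem_iff]
    rintro ⟨he, rfl | rfl, h⟩ <;> simp [he, h]
  have h1 := (Finset.card_le_card h).trans (Finset.card_union_le _ _)
  have h2 := hca v γ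
  have h3 := hcb v γ
  omega

/-- After orienting, each of `m + n` auxiliary colours occurs at a vertex at most twice, once
outgoing and once incoming. `T` takes the first `m` of these colours. -/
theorem exists_degree_split (z : E → Sym2 V) (S : Finset E) (hz : ∀ e ∈ S, ¬ (z e).IsDiag)
    (m n : ℕ) (hdeg : ∀ v, (S.filter (fun e => v ∈ z e)).card ≤ 2 * (m + n)) :
    ∃ T ⊆ S, (∀ v, (T.filter (fun e => v ∈ z e)).card ≤ 2 * m) ∧
      ∀ v, ((S \ T).filter (fun e => v ∈ z e)).card ≤ 2 * n := by
  obtain ⟨a, b, hab, ha, hb⟩ := exists_orientation_of_degree_le z S hz (m + n) hdeg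
  obtain ⟨κ, hκt, hκ⟩ := exists_proper_coloring_of_bipartite a b S (m + n) ha hb
  have hbound : ∀ (I : Finset ℕ) (T : Finset E), T ⊆ S → (∀ e ∈ T, κ e ∈ I) → ∀ v,
      (T.filter (fun e => v ∈ z e)).card ≤ 2 * I.card := by
    intro I T hTS hTI v
    have h1 : (T.filter (fun e => a e = v)).card ≤ I.card :=
      Finset.card_le_card_of_injOn κ (fun e he => hTI e (Finset.mem_filter.1 he).1) (by
        intro e he f hf h
        simp only [Finset.coe_filter, Set.mem_ofPred_eq] at he hf
        exact hκ e (hTS he.1) f (hTS hf.1) (Or.inl (he.2.trans hf.2.symm)) h)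
    have h2 : (T.filter (fun e => b e = v)).card ≤ I.card :=
      Finset.card_le_card_of_injOn κ (fun e he => hTI e (Finset.mem_filter.1 he).1) (by
        intro e he f hf h
        simp only [Finset.coe_filter, Set.mem_ofPred_eq] at he hf
        exact hκ e (hTS he.1) f (hTS hf.1) (Or.inr (he.2.trans hf.2.symm)) h)
    have h : T.filter (fun e => v ∈ z e) ⊆
        T.filter (fun e => a e = v) ∪ T.filter (fun e => b e = v) := by
      intro e
      simp only [Finset.mem_filter, Finset.mem_union, ← hab e, Sym2.mem_iff]
      rintro ⟨he, rfl | rfl⟩ <;> simp [he]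
    have h3 := (Finset.card_le_card h).trans (Finset.card_union_le _ _)
    omega
  refine ⟨S.filter (fun e => κ e < m), Finset.filter_subset _ _, fun v => ?_, fun v => ?_⟩
  · simpa using hbound (Finset.range m) _ (Finset.filter_subset _ _)
      (fun e he => by simpa using (Finset.mem_filter.1 he).2) v
  · have := hbound (Finset.Ico m (m + n)) (S \ S.filter (fun e => κ e < m)) Finset.sdiff_subset
      (fun e he => by
        simp only [Finset.mem_sdiff, Finset.mem_filter, not_and, not_lt] at he
        exact Finset.mem_Ico.2 ⟨he.2 he.1, hκt e he.1⟩) v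
    simpa using this

/-- In `exists_degree_split` one may choose `T` maximal. -/
theorem exists_maximal_degree_split (z : E → Sym2 V) (S : Finset E)
    (hz : ∀ e ∈ S, ¬ (z e).IsDiag)
    (m n : ℕ) (hdeg : ∀ v, (S.filter (fun e => v ∈ z e)).card ≤ 2 * (m + n)) :
    ∃ T ⊆ S, (∀ v, (T.filter (fun e => v ∈ z e)).card ≤ 2 * m) ∧
      (∀ v, ((S \ T).filter (fun e => v ∈ z e)).card ≤ 2 * n) ∧
      ∀ e ∈ S \ T, ∃ v ∈ z e, (T.filter (fun e => v ∈ z e)).card = 2 * m := by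
  classical
  obtain ⟨T₀, hT₀, h1, h2⟩ := exists_degree_split z S hz m n hdeg
  obtain ⟨T, hT, hmax⟩ := Finset.exists_max_image (S.powerset.filter (fun T =>
    (∀ v, (T.filter (fun e => v ∈ z e)).card ≤ 2 * m) ∧
      ∀ v, ((S \ T).filter (fun e => v ∈ z e)).card ≤ 2 * n)) Finset.card
    ⟨T₀, by simp only [Finset.mem_filter, Finset.mem_powerset]; exact ⟨hT₀, h1, h2⟩⟩
  simp only [Finset.mem_filter, Finset.mem_powerset] at hT hmax
  obtain ⟨hTS, hTm, hTn⟩ := hT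
  refine ⟨T, hTS, hTm, hTn, fun e he => ?_⟩
  obtain ⟨heS, heT⟩ := Finset.mem_sdiff.1 he
  by_contra! hcon
  have := hmax (insert e T) ⟨Finset.insert_subset heS hTS, fun v => ?_, fun v => ?_⟩
  · rw [Finset.card_insert_of_notMem heT] at this
    omega
  · rw [Finset.filter_insert]
    split_ifs with hv
    · have h3 := hcon v hv
      have h4 := hTm v
      have h5 := Finset.card_insert_le e (T.filter (fun e => v ∈ z e))
      omega
    · exact hTm v
  · refine (Finset.card_le_card (Finset.filter_subset_filter _ ?_)).trans (hTn v)
    exact Finset.sdiff_subset_sdiff le_rfl (Finset.subset_insert _ _)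

omit [DecidableEq E] in
/-- There is a cut that contains at least half of the edges at every vertex. -/
theorem exists_cut (a b : E → V) (S : Finset E) (hab : ∀ e ∈ S, a e ≠ b e) :
    ∃ σ : V → Bool, ∀ v, 2 * (S.filter (fun e => (v = a e ∨ v = b e) ∧ σ (a e) = σ (b e))).card ≤
      (S.filter (fun e => v = a e ∨ v = b e)).card := by
  -- Minimising the number of non-crossing edges works because flipping one vertex `v` exchanges
  -- crossing and non-crossing edges at `v`. The minimum exists because the values are natural
  -- numbers; `V` need not be finite.
  let F : (V → Bool) → ℕ := fun σ => (S.filter (fun e => σ (a e) = σ (b e))).card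
  obtain ⟨σ, hσ⟩ : ∃ σ, ∀ τ, F σ ≤ F τ :=
    ⟨Function.argmin F, fun τ => Function.argmin_le F τ⟩
  refine ⟨σ, fun v => ?_⟩
  have hle := hσ (Function.update σ v (!σ v))
  have hid : F (Function.update σ v (!σ v)) +
      2 * (S.filter (fun e => (v = a e ∨ v = b e) ∧ σ (a e) = σ (b e))).card =
      F σ + (S.filter (fun e => v = a e ∨ v = b e)).card := by
    simp only [F, Finset.card_filter, Finset.mul_sum, ← Finset.sum_add_distrib]
    refine Finset.sum_congr rfl fun e he => ?_
    have hne := hab e he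
    by_cases h1 : a e = v
    · have h2 : b e ≠ v := fun h => hne (h1.trans h.symm)
      subst h1
      simp only [Function.update_self, Function.update_of_ne h2]
      cases σ (a e) <;> cases σ (b e) <;> simp
    · by_cases h2 : b e = v
      · subst h2
        simp only [Function.update_self, Function.update_of_ne h1]
        cases σ (a e) <;> cases σ (b e) <;> simp
      · simp [Function.update_of_ne h1, Function.update_of_ne h2, Ne.symm h1, Ne.symm h2]
  omega

theorem exists_greedy_list_coloring {C : Type*} [DecidableEq C] [Inhabited C] (r : E → E → Prop)
    [DecidableRel r] (hrefl : ∀ e, r e e) (hsymm : ∀ e f, r e f → r f e) (S : Finset E)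
    (L : E → Finset C) (hL : ∀ e ∈ S, (S.filter (fun f => r e f)).card ≤ (L e).card) :
    ∃ c : E → C, (∀ e ∈ S, c e ∈ L e) ∧ ∀ e ∈ S, ∀ f ∈ S, r e f → c e = c f → e = f := by
  induction S using Finset.induction_on with
  | empty => exact ⟨fun _ => default, by simp, by simp⟩
  | insert x S hx ih =>
    obtain ⟨c, hcL, hc⟩ := ih (fun e he => (Finset.card_le_card
      (Finset.filter_subset_filter _ (Finset.subset_insert _ _))).trans
      (hL e (Finset.mem_insert_of_mem he)))
    obtain ⟨γ, hγ, hγ'⟩ : ∃ γ ∈ L x, γ ∉ (S.filter (fun f => r x f)).image c := by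
      apply Finset.exists_mem_notMem_of_card_lt_card
      refine Finset.card_image_le.trans_lt (lt_of_lt_of_le ?_ (hL x (Finset.mem_insert_self _ _)))
      rw [Finset.filter_insert, if_pos (hrefl x), Finset.card_insert_of_notMem (by simp [hx])]
      exact Nat.lt_succ_self _
    have hne : ∀ f ∈ S, r x f → c f ≠ γ := fun f hf hr h =>
      hγ' (Finset.mem_image.2 ⟨f, Finset.mem_filter.2 ⟨hf, hr⟩, h⟩)
    have hSx : ∀ f ∈ S, f ≠ x := fun f hf h => hx (h ▸ hf)
    refine ⟨Function.update c x γ, ?_, ?_⟩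
    · intro e he
      rcases Finset.mem_insert.1 he with rfl | he
      · simpa using hγ
      · simpa [Function.update_of_ne (hSx e he)] using hcL e he
    · intro e he f hf hr hcol
      rcases Finset.mem_insert.1 he with rfl | he' <;> rcases Finset.mem_insert.1 hf with rfl | hf'
      · rfl
      · rw [Function.update_self, Function.update_of_ne (hSx f hf')] at hcol
        exact absurd hcol.symm (hne f hf' hr)
      · rw [Function.update_self, Function.update_of_ne (hSx e he')] at hcol
        exact absurd hcol (hne e he' (hsymm _ _ hr))
      · rw [Function.update_of_ne (hSx f hf'), Function.update_of_ne (hSx e he')] at hcol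
        exact hc e he' f hf' hr hcol

/-- A multigraph has a proper list edge colouring if the list of every edge `uv` has size at least
`d(u) + d(v) / 2` and `d(v) + d(u) / 2`. -/
theorem exists_proper_list_coloring {C : Type*} [DecidableEq C] [Inhabited C] (z : E → Sym2 V)
    (S : Finset E) (hz : ∀ e ∈ S, ¬ (z e).IsDiag) (L : E → Finset C)
    (hL : ∀ e ∈ S, ∀ u v, z e = s(u, v) → (S.filter (fun f => u ∈ z f)).card +
      (S.filter (fun f => v ∈ z f)).card / 2 ≤ (L e).card) :
    ∃ c : E → C, (∀ e ∈ S, c e ∈ L e) ∧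
      ∀ e ∈ S, ∀ f ∈ S, (∃ v, v ∈ z e ∧ v ∈ z f) → c e = c f → e = f := by
  classical
  obtain ⟨a, b, hab, -⟩ := exists_balanced_orientation z S
  have hmem : ∀ v e, v ∈ z e ↔ v = a e ∨ v = b e := fun v e => by rw [← hab e, Sym2.mem_iff]
  obtain ⟨σ, hσ⟩ := exists_cut a b S (fun e he h => hz e he (by rw [← hab e, h]; simp))
  simp only [← hmem] at hσ
  set R := S.filter (fun e => σ (a e) = σ (b e)) with hR
  set H := S.filter (fun e => ¬ σ (a e) = σ (b e)) with hH
  have hRS : R ⊆ S := Finset.filter_subset _ _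
  have hRdeg : ∀ v, 2 * (R.filter (fun f => v ∈ z f)).card ≤ (S.filter (fun f => v ∈ z f)).card := by
    intro v
    refine le_trans (le_of_eq ?_) (hσ v)
    rw [hR, Finset.filter_filter]
    simp only [and_comm]
  have hRH : ∀ v, (R.filter (fun f => v ∈ z f)).card + (H.filter (fun f => v ∈ z f)).card =
      (S.filter (fun f => v ∈ z f)).card := by
    intro v
    rw [hR, hH, Finset.filter_comm, Finset.filter_comm (p := fun e => ¬ σ (a e) = σ (b e)),
      Finset.card_filter_add_card_filter_not]
  have hRnbr : ∀ e u w, z e = s(u, w) → (R.filter (fun f => ∃ v, v ∈ z e ∧ v ∈ z f)).card ≤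
      (R.filter (fun f => u ∈ z f)).card + (R.filter (fun f => w ∈ z f)).card := by
    intro e u w huw
    refine le_trans (Finset.card_le_card ?_) (Finset.card_union_le _ _)
    intro f
    simp only [Finset.mem_filter, Finset.mem_union, huw, Sym2.mem_iff]
    rintro ⟨hf, v, rfl | rfl, h⟩ <;> simp [hf, h]
  obtain ⟨c₀, hc₀L, hc₀⟩ := exists_greedy_list_coloring (fun e f => ∃ v, v ∈ z e ∧ v ∈ z f)
    (fun e => ⟨a e, (hmem _ _).2 (Or.inl rfl), (hmem _ _).2 (Or.inl rfl)⟩)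
    (fun e f ⟨v, h1, h2⟩ => ⟨v, h2, h1⟩) R L (by
      intro e he
      have h1 := hRnbr e _ _ (hab e).symm
      have h2 := hL e (hRS he) _ _ (hab e).symm
      have h3 := hRdeg (a e)
      have h4 := hRdeg (b e)
      omega)
  -- Crossing edges are reoriented so that `a'` lies on the `true` side of the cut and `b'` on the
  -- `false` side.
  set a' : E → V := fun e => if σ (a e) then a e else b e with ha'
  set b' : E → V := fun e => if σ (a e) then b e else a e with hb'
  have hab' : ∀ e, z e = s(a' e, b' e) := by
    intro e
    simp only [ha', hb', ← hab e]
    split_ifs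
    · rfl
    · exact Sym2.eq_swap
  have hmem' : ∀ v e, v ∈ z e ↔ v = a' e ∨ v = b' e := fun v e => by rw [hab' e, Sym2.mem_iff]
  have hσa : ∀ e ∈ H, σ (a' e) = true := by
    intro e he
    have h := (Finset.mem_filter.1 he).2
    simp only [ha']
    split_ifs with h1
    · exact h1
    · exact Bool.eq_true_of_not_eq_false fun h2 => h ((Bool.eq_false_of_not_eq_true h1).trans h2.symm)
  have hσb : ∀ e ∈ H, σ (b' e) = false := by
    intro e he
    have h := (Finset.mem_filter.1 he).2
    simp only [hb']
    split_ifs with h1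
    · exact Bool.eq_false_of_not_eq_true fun h2 => h (h1.trans h2.symm)
    · exact Bool.eq_false_of_not_eq_true h1
  -- Removing the colours used on adjacent `R`-edges leaves at least `d(u) + ⌊d(w)/2⌋ - d_R(u) -
  -- d_R(w) ≥ d_H(u)` colours.
  have hfib : ∀ e ∈ H, ∀ u w, z e = s(u, w) → (H.filter (fun f => u ∈ z f)).card ≤
      (L e \ (R.filter (fun f => ∃ v, v ∈ z e ∧ v ∈ z f)).image c₀).card := by
    intro e he u w huw
    have h1 := hRnbr e u w huw
    have h2 := hL e (Finset.mem_filter.1 he).1 u w huw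
    have h3 := hRdeg w
    have h4 := hRH u
    have h5 := Finset.le_card_sdiff ((R.filter (fun f => ∃ v, v ∈ z e ∧ v ∈ z f)).image c₀) (L e)
    have h6 := Finset.card_image_le (s := R.filter (fun f => ∃ v, v ∈ z e ∧ v ∈ z f)) (f := c₀)
    omega
  obtain ⟨c₁, hc₁L, hc₁⟩ := exists_proper_list_coloring_of_bipartite a' b' H
    (fun e => L e \ (R.filter (fun f => ∃ v, v ∈ z e ∧ v ∈ z f)).image c₀)
    (fun e he => (Finset.card_le_card (Finset.monotone_filter_right _
      (fun f _ h => (hmem' _ f).2 (Or.inl h.symm)))).trans (hfib e he _ _ (hab' e)))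
    (fun e he => (Finset.card_le_card (Finset.monotone_filter_right _
      (fun f _ h => (hmem' _ f).2 (Or.inr h.symm)))).trans
        (hfib e he _ _ ((hab' e).trans Sym2.eq_swap)))
  have hHR : ∀ e ∈ S, e ∉ R → e ∈ H := fun e he h =>
    Finset.mem_filter.2 ⟨he, fun h' => h (Finset.mem_filter.2 ⟨he, h'⟩)⟩
  have hcross : ∀ e ∈ R, ∀ f ∈ H, (∃ v, v ∈ z f ∧ v ∈ z e) → c₀ e ≠ c₁ f := by
    intro e he f hf hv h
    refine (Finset.mem_sdiff.1 (hc₁L f hf)).2 (Finset.mem_image.2 ⟨e, ?_, h⟩)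
    exact Finset.mem_filter.2 ⟨he, hv⟩
  refine ⟨fun e => if e ∈ R then c₀ e else c₁ e, fun e he => ?_, ?_⟩
  · by_cases heR : e ∈ R
    · simpa [heR] using hc₀L e heR
    · simpa [heR] using (Finset.mem_sdiff.1 (hc₁L e (hHR e he heR))).1
  · intro e he f hf hv hcol
    by_cases heR : e ∈ R <;> by_cases hfR : f ∈ R <;> simp only [heR, hfR, if_true, if_false] at hcol
    · exact hc₀ e heR f hfR hv hcol
    · exact absurd hcol (hcross e heR f (hHR f hf hfR) (hv.imp fun _ h => h.symm))
    · exact absurd hcol.symm (hcross f hfR e (hHR e he heR) hv)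
    · have heH := hHR e he heR
      have hfH := hHR f hf hfR
      refine hc₁ e heH f hfH ?_ hcol
      obtain ⟨v, hve, hvf⟩ := hv
      rcases (hmem' _ _).1 hve with h1 | h1 <;> rcases (hmem' _ _).1 hvf with h2 | h2
      · exact Or.inl (h1.symm.trans h2)
      · have := hσa e heH
        rw [← h1, h2, hσb f hfH] at this
        simp at this
      · have := hσb e heH
        rw [← h1, h2, hσa f hfH] at this
        simp at this
      · exact Or.inr (h1.symm.trans h2)

theorem exists_odd_frugal_list_coloring {C : Type*} [DecidableEq C] [Inhabited C] (z : E → Sym2 V)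
    (S : Finset E) (hz : ∀ e ∈ S, ¬ (z e).IsDiag) (j t D : ℕ) (hD : 3 * D ≤ 2 * t)
    (hdeg : ∀ v, (S.filter (fun e => v ∈ z e)).card ≤ 2 * (j * t) + D)
    (L : E → Finset C) (hL : ∀ e ∈ S, t ≤ (L e).card) :
    ∃ c : E → C, (∀ e ∈ S, c e ∈ L e) ∧
      ∀ v γ, (S.filter (fun e => v ∈ z e ∧ c e = γ)).card ≤ 2 * j + 1 := by
  -- The split needs even degree bounds, so `D` is rounded up to an even number.
  obtain ⟨T, hTS, hT1, hT2, hT3⟩ := exists_maximal_degree_split z S hz (j * t) ((D + 1) / 2)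
    (fun v => (hdeg v).trans (by omega))
  have hsplit : ∀ v, (T.filter (fun f => v ∈ z f)).card + ((S \ T).filter (fun f => v ∈ z f)).card =
      (S.filter (fun f => v ∈ z f)).card := by
    intro v
    rw [← Finset.card_union_of_disjoint, ← Finset.filter_union, Finset.union_sdiff_of_subset hTS]
    exact Finset.disjoint_filter_filter Finset.disjoint_sdiff
  obtain ⟨c₁, hc₁L, hc₁⟩ := exists_even_frugal_list_coloring z T (fun e he => hz e (hTS he)) j t hT1
    L (fun e he => hL e (hTS he))
  obtain ⟨c₂, hc₂L, hc₂⟩ := exists_proper_list_coloring z (S \ T)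
    (fun e he => hz e (Finset.mem_sdiff.1 he).1) L (by
      intro e he u v huv
      refine le_trans ?_ (hL e (Finset.mem_sdiff.1 he).1)
      -- By maximality some end `x` is saturated in `T`, so its remaining degree is at most `D`; the
      -- other end may have `D + 1` when `D` is odd. Then `d(u) + ⌊d(v)/2⌋ ≤ (3D + 1)/2`, which is
      -- at most `t` because `3D` is odd and `3D ≤ 2t`.
      obtain ⟨x, hx, hxT⟩ := hT3 e he
      have h1 := hsplit x
      have h2 := hdeg x
      have h3 := hT2 u
      have h4 := hT2 v
      rw [huv, Sym2.mem_iff] at hx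
      rcases hx with rfl | rfl <;> omega)
  refine ⟨fun e => if e ∈ T then c₁ e else c₂ e, fun e he => ?_, fun v γ => ?_⟩
  · by_cases heT : e ∈ T
    · simpa [heT] using hc₁L e heT
    · simpa [heT] using hc₂L e (by simp [he, heT])
  · have h1 : S.filter (fun e => v ∈ z e ∧ (if e ∈ T then c₁ e else c₂ e) = γ) ⊆
        T.filter (fun e => v ∈ z e ∧ c₁ e = γ) ∪ (S \ T).filter (fun e => v ∈ z e ∧ c₂ e = γ) := by
      intro e
      simp only [Finset.mem_filter, Finset.mem_union, Finset.mem_sdiff]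
      by_cases heT : e ∈ T <;> simp [heT]
    have h2 : ((S \ T).filter (fun e => v ∈ z e ∧ c₂ e = γ)).card ≤ 1 := by
      rw [Finset.card_le_one]
      intro e he f hf
      obtain ⟨he, hve, hce⟩ := Finset.mem_filter.1 he
      obtain ⟨hf, hvf, hcf⟩ := Finset.mem_filter.1 hf
      exact hc₂ e he f hf ⟨v, hve, hvf⟩ (hce.trans hcf.symm)
    exact ((Finset.card_le_card h1).trans (Finset.card_union_le _ _)).trans
      (add_le_add (hc₁ v γ) h2)

end Multigraph

/-! ### Passage to `Graph` and the general bounds -/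

section Transfer

variable {α β : Type*} (G : Graph α β)

open scoped Graph

/-- Bridge to the colouring lemmas, where edges are bare labels with a map to `Sym2`, so that their
ends can be altered by `Function.update`. -/
theorem exists_ends : ∃ z : E(G) → Sym2 α, (∀ e v, v ∈ z e ↔ G.Inc (e : β) v) ∧
    (G.Loopless → ∀ e, ¬ (z e).IsDiag) := by
  have h : ∀ e : E(G), ∃ p : α × α, G.IsLink (e : β) p.1 p.2 := fun e => by
    obtain ⟨x, y, h⟩ := G.exists_isLink_of_mem_edgeSet e.2
    exact ⟨(x, y), h⟩
  choose p hp using h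
  refine ⟨fun e => s((p e).1, (p e).2), fun e v => ?_, fun hG e he => ?_⟩
  · rw [Sym2.mem_iff]
    constructor
    · rintro (rfl | rfl)
      · exact (hp e).inc_left
      · exact (hp e).inc_right
    · exact fun h => h.eq_or_eq_of_isLink (hp e)
  · rw [Sym2.mk_isDiag_iff] at he
    have := hp e
    rw [he] at this
    exact hG.not_isLoopAt _ _ this

open Classical in
theorem degree_eq_card [Fintype E(G)] (v : α) :
    degree G v = (Finset.univ.filter (fun e : E(G) => G.Inc (e : β) v)).card := by
  have h : {e : β | G.Inc e v} = (fun e : E(G) => (e : β)) ''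
      (Finset.univ.filter (fun e : E(G) => G.Inc (e : β) v) : Finset E(G)) := by
    ext e
    simp only [Set.mem_ofPred_eq, Finset.coe_filter, Finset.mem_univ, true_and, Set.mem_image,
      Subtype.exists, exists_and_left, exists_prop, exists_eq_right_right]
    exact ⟨fun h => ⟨h, h.edge_mem⟩, fun h => h.1⟩
  rw [degree, h, Set.ncard_image_of_injective _ Subtype.val_injective, Set.ncard_coe_finset]

open Classical in
theorem isFrugal_iff [Fintype E(G)] {C : Type*} (k : ℕ) (c : E(G) → C) :
    IsFrugal G k c ↔ ∀ v ∈ V(G), ∀ a,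
      (Finset.univ.filter (fun e : E(G) => G.Inc (e : β) v ∧ c e = a)).card ≤ k := by
  refine forall₃_congr fun v _ a => ?_
  rw [← Nat.cast_le (α := ℕ∞), ← Set.encard_coe_eq_coe_finsetCard]
  simp

theorem degree_le_maxDegree (hV : V(G).Finite) (v : α) : degree G v ≤ maxDegree G := by
  by_cases hv : v ∈ V(G)
  · exact le_csSup (hV.image _).bddAbove (Set.mem_image_of_mem _ hv)
  · have : {e : β | G.Inc e v} = ∅ := by
      ext e
      simp only [Set.mem_ofPred_eq, Set.mem_empty_iff_false, iff_false]
      exact fun h => hv h.vertex_mem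
    simp [degree, this]

/-- The numerical hypothesis is `3Δ ≤ (3k - 1)t` without subtraction; for `k = 2j + 1` it gives `Δ ≤
2jt + ⌊2t/3⌋`. -/
theorem edgeChoosable_of_odd (hG : G.Loopless) (hV : V(G).Finite) (hE : E(G).Finite) {k t : ℕ}
    (hk : Odd k) (ht : 3 * maxDegree G + t ≤ t * (3 * k)) : EdgeChoosable G k t := by
  classical
  obtain ⟨j, rfl⟩ := hk
  intro L hL
  have := hE.fintype
  obtain ⟨z, hz, hzd⟩ := exists_ends G
  have hdeg : ∀ v, (Finset.univ.filter (fun e : E(G) => v ∈ z e)).card ≤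
      2 * (j * t) + 2 * t / 3 := by
    intro v
    simp only [hz]
    rw [← degree_eq_card]
    have h1 := degree_le_maxDegree G hV v
    have h2 : t * (3 * (2 * j + 1)) = 6 * (j * t) + 3 * t := by ring
    omega
  obtain ⟨c, hcL, hc⟩ := exists_odd_frugal_list_coloring z Finset.univ (fun e _ => hzd hG e) j t
    (2 * t / 3) (by omega) hdeg L (fun e _ => (hL e).ge)
  refine ⟨c, fun e => hcL e (Finset.mem_univ e), (isFrugal_iff G _ c).2 fun v _ a => ?_⟩
  have h := hc v a
  simp only [hz] at h
  convert h

theorem EdgeChoosable.edgeColorable {G : Graph α β} {k t : ℕ} (h : EdgeChoosable G k t) :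
    EdgeColorable G k t := by
  obtain ⟨c, hc, hfr⟩ := h (fun _ => (Finset.range t).map Nat.castEmbedding) (by simp)
  have hc' : ∀ e, ∃ i : Fin t, ((i : ℕ) : ℤ) = c e := by
    intro e
    obtain ⟨i, hi, h⟩ := Finset.mem_map.1 (hc e)
    exact ⟨⟨i, Finset.mem_range.1 hi⟩, h⟩
  choose c' hc' using hc'
  refine ⟨c', fun v hv a => ?_⟩
  have := hfr v hv ((a : ℕ) : ℤ)
  refine le_trans (Set.encard_le_encard ?_) this
  rintro e ⟨h1, h2⟩
  exact ⟨h1, by rw [← hc' e, h2]⟩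

theorem EdgeColorable.maxDegree_le {G : Graph α β} {k t : ℕ} (hE : E(G).Finite)
    (h : EdgeColorable G k t) : maxDegree G ≤ t * k := by
  classical
  obtain ⟨c, hc⟩ := h
  have := hE.fintype
  rw [isFrugal_iff] at hc
  refine csSup_le' ?_
  rintro _ ⟨v, hv, rfl⟩
  rw [degree_eq_card, Finset.card_eq_sum_card_fiberwise (f := c) (t := Finset.univ) (by simp)]
  refine (Finset.sum_le_card_nsmul _ _ k fun a _ => ?_).trans (by simp)
  rw [Finset.filter_filter]
  exact le_of_eq_of_le (by congr!) (hc v hv a)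

theorem ceil_maxDegree_div_le_chromaticIndex {k : ℕ} (hE : E(G).Finite) :
    ((⌈(maxDegree G : ℚ) / (k : ℚ)⌉₊ : ℕ) : ℕ∞) ≤ chromaticIndex G k := by
  refine le_iInf₂ fun t ht => ?_
  rw [Nat.cast_le, Nat.ceil_le]
  refine div_le_of_le_mul₀ (Nat.cast_nonneg _) (Nat.cast_nonneg _) ?_
  exact_mod_cast ht.maxDegree_le hE

theorem chromaticIndex_le_choiceIndex (k : ℕ) : chromaticIndex G k ≤ choiceIndex G k :=
  le_iInf₂ fun t ht => iInf₂_le t ht.edgeColorable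

theorem choiceIndex_le_of_odd (hG : G.Loopless) (hV : V(G).Finite) (hE : E(G).Finite) {k : ℕ}
    (hk : Odd k) : choiceIndex G k ≤
      ((⌈3 * (maxDegree G : ℚ) / (3 * (k : ℚ) - 1)⌉₊ : ℕ) : ℕ∞) := by
  refine iInf₂_le _ (edgeChoosable_of_odd G hG hV hE hk ?_)
  have hk1 : (1 : ℚ) ≤ k := by exact_mod_cast hk.pos
  have h := Nat.le_ceil (3 * (maxDegree G : ℚ) / (3 * (k : ℚ) - 1))
  rw [div_le_iff₀ (by linarith)] at h
  have h' : 3 * (maxDegree G : ℚ) + (⌈3 * (maxDegree G : ℚ) / (3 * (k : ℚ) - 1)⌉₊ : ℚ) ≤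
      (⌈3 * (maxDegree G : ℚ) / (3 * (k : ℚ) - 1)⌉₊ : ℚ) * (3 * k) := by linarith
  exact_mod_cast h'

end Transfer

/-! ### Tightness for the triangle multigraphs -/

section Triangle

open scoped Graph

theorem triangle_inc {m : ℕ} {e : Fin 3 × Fin m} {v : Fin 3} :
    (triangle m).Inc e v ↔ v = e.1 ∨ v = e.1 + 1 := by
  constructor
  · rintro ⟨y, h⟩
    rcases Sym2.eq_iff.1 h with ⟨h, -⟩ | ⟨h, -⟩
    · exact Or.inl h
    · exact Or.inr h
  · rintro (rfl | rfl)
    · exact ⟨e.1 + 1, rfl⟩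
    · exact ⟨e.1, Sym2.eq_swap⟩

theorem triangle_loopless (m : ℕ) : (triangle m).Loopless := by
  refine ⟨fun e x h => ?_⟩
  have h' : s(x, x) = s(e.1, e.1 + 1) := h
  have hne : e.1 ≠ e.1 + 1 := by
    generalize e.1 = i
    revert i
    decide
  rcases Sym2.eq_iff.1 h' with ⟨h1, h2⟩ | ⟨h1, h2⟩
  · exact hne (h1.symm.trans h2)
  · exact hne (h2.symm.trans h1)

theorem degree_triangle (m : ℕ) (v : Fin 3) : degree (triangle m) v = 2 * m := by
  have h : {e : Fin 3 × Fin m | (triangle m).Inc e v} =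
      ((Finset.univ.filter (fun i : Fin 3 => v = i ∨ v = i + 1) ×ˢ Finset.univ :
        Finset (Fin 3 × Fin m)) : Set (Fin 3 × Fin m)) := by
    ext e
    simp [triangle_inc]
  have h2 : ∀ v : Fin 3, (Finset.univ.filter (fun i : Fin 3 => v = i ∨ v = i + 1)).card = 2 := by
    decide
  rw [degree, h, Set.ncard_coe_finset, Finset.card_product, h2]
  simp

theorem maxDegree_triangle (m : ℕ) : maxDegree (triangle m) = 2 * m := by
  have h : degree (triangle m) '' V(triangle m) = {2 * m} := by
    have hV : V(triangle m) = Set.univ := rfl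
    ext n
    simp [degree_triangle, hV]
  rw [maxDegree, h, csSup_singleton]

theorem card_edges_le_of_triangle_colorable {m k t : ℕ} (hk : Odd k)
    (h : EdgeColorable (triangle m) k t) : 6 * m + t ≤ t * (3 * k) := by
  classical
  obtain ⟨c, hc⟩ := h
  have : Fintype E(triangle m) := (Set.toFinite E(triangle m)).fintype
  rw [isFrugal_iff] at hc
  have hcard : Fintype.card E(triangle m) = 3 * m := by
    have hE : E(triangle m) = Set.univ := rfl
    rw [← Nat.card_eq_fintype_card, hE, Nat.card_univ]
    simp
  have hcol : ∀ a : Fin t,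
      2 * (Finset.univ.filter (fun e : E(triangle m) => c e = a)).card + 1 ≤ 3 * k := by
    intro a
    have h1 : 2 * (Finset.univ.filter (fun e : E(triangle m) => c e = a)).card =
        ∑ v : Fin 3, (Finset.univ.filter
          (fun e : E(triangle m) => (triangle m).Inc (e : Fin 3 × Fin m) v ∧ c e = a)).card := by
      have h3 : ∀ i : Fin 3, ∑ v : Fin 3, (if v = i ∨ v = i + 1 then 1 else 0) = 2 := by decide
      simp only [Finset.card_filter]
      rw [Finset.sum_comm, Finset.mul_sum]
      refine Finset.sum_congr rfl fun e _ => ?_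
      by_cases he : c e = a
      · simp only [he, and_true, if_true, triangle_inc]
        rw [mul_one]
        convert (h3 (e : Fin 3 × Fin m).1).symm
      · simp [he]
    have h2 : ∑ v : Fin 3, (Finset.univ.filter
          (fun e : E(triangle m) => (triangle m).Inc (e : Fin 3 × Fin m) v ∧ c e = a)).card ≤
        3 * k := by
      refine (Finset.sum_le_card_nsmul Finset.univ _ k fun v _ => ?_).trans (by simp)
      exact le_of_eq_of_le (by congr!) (hc v (Set.mem_univ v) a)
    -- Double counting gives twice the class size at most `3k`; since `3k` is odd, equality is
    -- impossible. This is the source of the `-1` in the denominator.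
    obtain ⟨j, rfl⟩ := hk
    omega
  have hsum : 3 * m = ∑ a : Fin t, (Finset.univ.filter (fun e : E(triangle m) => c e = a)).card := by
    rw [← hcard, ← Finset.card_univ]
    exact Finset.card_eq_sum_card_fiberwise (by simp)
  have h1 : ∑ a : Fin t, (2 * (Finset.univ.filter (fun e : E(triangle m) => c e = a)).card + 1) ≤
      t * (3 * k) :=
    (Finset.sum_le_card_nsmul _ _ (3 * k) fun a _ => hcol a).trans (by simp)
  rw [Finset.sum_add_distrib, ← Finset.mul_sum, ← hsum] at h1
  simp at h1
  omega

theorem le_chromaticIndex_triangle (m : ℕ) {k : ℕ} (hk : Odd k) :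
    ((⌈3 * (maxDegree (triangle m) : ℚ) / (3 * (k : ℚ) - 1)⌉₊ : ℕ) : ℕ∞) ≤
      chromaticIndex (triangle m) k := by
  refine le_iInf₂ fun t ht => ?_
  have hk1 : (1 : ℚ) ≤ k := by exact_mod_cast hk.pos
  have h : ((6 * m + t : ℕ) : ℚ) ≤ ((t * (3 * k) : ℕ) : ℚ) :=
    Nat.cast_le.2 (card_edges_le_of_triangle_colorable hk ht)
  rw [Nat.cast_le, Nat.ceil_le, div_le_iff₀ (by linarith), maxDegree_triangle]
  push_cast at h ⊢
  linarith

end Triangle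
end FrugalEdge

theorem mainTheorem2 (k : ℕ) (hk : Odd k) :
    (∀ (α β : Type*) (G : Graph α β), G.Loopless → G.vertexSet.Finite → G.edgeSet.Finite →
      ((⌈(FrugalEdge.maxDegree G : ℚ) / (k : ℚ)⌉₊ : ℕ) : ℕ∞) ≤ FrugalEdge.chromaticIndex G k ∧
      FrugalEdge.chromaticIndex G k ≤ FrugalEdge.choiceIndex G k ∧
      FrugalEdge.choiceIndex G k ≤
        ((⌈3 * (FrugalEdge.maxDegree G : ℚ) / (3 * (k : ℚ) - 1)⌉₊ : ℕ) : ℕ∞)) ∧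
    (∀ m : ℕ, 1 ≤ m →
      (FrugalEdge.triangle m).Loopless ∧
      FrugalEdge.maxDegree (FrugalEdge.triangle m) = 2 * m ∧
      FrugalEdge.chromaticIndex (FrugalEdge.triangle m) k =
        ((⌈3 * (FrugalEdge.maxDegree (FrugalEdge.triangle m) : ℚ) / (3 * (k : ℚ) - 1)⌉₊ : ℕ) : ℕ∞) ∧
      FrugalEdge.choiceIndex (FrugalEdge.triangle m) k =
        ((⌈3 * (FrugalEdge.maxDegree (FrugalEdge.triangle m) : ℚ) / (3 * (k : ℚ) - 1)⌉₊ : ℕ) : ℕ∞)) := by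
  refine ⟨fun α β G hG hV hE => ⟨FrugalEdge.ceil_maxDegree_div_le_chromaticIndex G hE,
    FrugalEdge.chromaticIndex_le_choiceIndex G k, FrugalEdge.choiceIndex_le_of_odd G hG hV hE hk⟩,
    fun m _ => ?_⟩
  have hlower := FrugalEdge.le_chromaticIndex_triangle m hk
  have hmid := FrugalEdge.chromaticIndex_le_choiceIndex (FrugalEdge.triangle m) k
  have hupper := FrugalEdge.choiceIndex_le_of_odd (FrugalEdge.triangle m)
    (FrugalEdge.triangle_loopless m) (Set.toFinite _) (Set.toFinite _) hk
  exact ⟨FrugalEdge.triangle_loopless m, FrugalEdge.maxDegree_triangle m,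
    le_antisymm (hmid.trans hupper) hlower, le_antisymm hupper (hlower.trans hmid)⟩
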